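/- Let $\zeta_1,\zeta_2,\zeta_3$ be the substitutions on $\{1,2,3\}$ given by $$\zeta_1: 1\mapsto 1,\ 2\mapsto 2,\ 3\mapsto 23;\qquad \zeta_2: 1\mapsto 1,\ 2\mapsto 3,\ 3\mapsto 32;\qquad \zeta_3: 1\mapsto 2,\ 2\mapsto 3,\ 3\mapsto 31,$$ and put $\tau_j=\zeta_1^{\,j}\zeta_2\zeta_1\zeta_3^{2}\zeta_1$ for $j\ge 0$, $\rho_c=\tau_{c-1}\tau_{c-2}\cdots\tau_1\tau_0$ for $c\ge 1$, and $N(c)=c(c+1)/2+3c$. A limit word of a sequence $(\sigma_n)_{n\ge0}$ of substitutions is an infinite word $\omega=\omega^{(0)}$ for which there are infinite words $\omega^{(n)}$ with $\omega^{(n)}=\sigma_n(\omega^{(n+1)})$ for all $n\ge 0$. For letters $i\ne j$ in $\{1,2,3\}$ let $\beta_{ij}$ be the substitution $j\mapsto ij$, $k\mapsto k$ for $k\neq j$. A Brun word (on three letters) is a limit word of a sequence $(\sigma_n)$ of substitutions $\beta_{ij}$, its directive sequence, in which each pair $\sigma_n\sigma_{n+1}$ is of the form $\beta_{ij}\beta_{ij}$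 or $\beta_{ij}\beta_{jk}$ with $k\ne j$ (and $k=i$ allowed), and in which for each letter $i$ some $\beta_{ij}$ occurs infinitely often. For such a sequence $(\sigma_n)$ define $(\tilde\sigma_n)$ by $\tilde\sigma_0=\zeta_1$ and, for $n\ge1$, $\tilde\sigma_n=\zeta_1$, $\zeta_2$ or $\zeta_3$ according to whether $\sigma_{n-1}\sigma_n$ is $\beta_{ij}\beta_{ij}$, $\beta_{ij}\beta_{ji}$ or $\beta_{ij}\beta_{jk}$ with $\{i,j,k\}=\{1,2,3\}$. An infinite word is finitely balanced if there is $C\in\mathbb N$ such that, for any two of its factors $u,v$ of the same length and each letter $j$, the numbers of occurrences of $j$ in $u$ and in $v$ differ by at most $C$. Let $(c_k)_{k\ge0}$ be a sequence of natural numbers such that $$c_k>12\sqrt3\cdot 3^{N(c_0)+N(c_1)+\cdots+N(c_{k-1})}\,k\qquad\text{for all } k\ge 0,$$ and consider the sequence $\rho_{c_0}\rho_{c_1}\rho_{c_2}\cdots$ of substitutions $\zeta_1,\zeta_2,\zeta_3$. Then: 1. This sequence has exactly one limit word; this limit word is a Brun word, and it is not finitely balanced. 2. If $(\sigma_n)$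 is a directive sequence of a Brun word as above with $\tilde\sigma_0\tilde\sigma_1\tilde\sigma_2\cdots=\rho_{c_0}\rho_{c_1}\rho_{c_2}\cdots$, then $(\sigma_n)$ has exactly one limit word, and this Brun word is not finitely balanced. -/

import Mathlib

namespace Brun

/-- A substitution over `A`, given by the images of the letters: the endomorphism of the free
monoid `A*` that it determines sends a finite word `w` to `w.flatMap σ`. -/
abbrev Substitution (A : Type*) := A → List A

/-- The infinite concatenation `L 0 ++ L 1 ++ L 2 ++ ⋯` of a sequence of non-empty blocks.
(Its `n`-th entry already lies in the first `n + 1` blocks; `default` is never reached.) -/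
def infConcat {α : Type*} [Inhabited α] (L : ℕ → List α) : ℕ → α :=
  fun n => ((List.range (n + 1)).flatMap L).getD n default

/-- The natural extension of a (non-erasing) substitution to infinite words,
`w ↦ σ(w₀) σ(w₁) σ(w₂) ⋯`. -/
def Substitution.applyInf {A : Type*} [Inhabited A] (σ : Substitution A) (w : ℕ → A) : ℕ → A :=
  infConcat (fun n => σ (w n))

/-- `ω` is a limit word of the directive sequence `σ`: there are infinite words
`ω = ω⁽⁰⁾, ω⁽¹⁾, ω⁽²⁾, …` with `ω⁽ⁿ⁾ = σₙ(ω⁽ⁿ⁺¹⁾)` for all `n`. -/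
def IsLimitWord {A : Type*} [Inhabited A] (σ : ℕ → Substitution A) (ω : ℕ → A) : Prop :=
  ∃ W : ℕ → ℕ → A, W 0 = ω ∧ ∀ n, W n = (σ n).applyInf (W (n + 1))

/-- `u` is a factor `ω_k ω_{k+1} ⋯ ω_{k+n-1}` of the infinite word `ω`. -/
def IsFactor {A : Type*} (u : List A) (ω : ℕ → A) : Prop :=
  ∃ k n : ℕ, u = (List.range n).map (fun m => ω (k + m))

/-- `ω` is `C`-balanced: in any two factors of the same length, the numbers of occurrences of
each letter differ by at most `C`. -/
def IsBalanced {A : Type*} [DecidableEq A] (C : ℕ) (ω : ℕ → A) : Prop :=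
  ∀ u v : List A, IsFactor u ω → IsFactor v ω → u.length = v.length →
    ∀ j : A, |(u.count j : ℤ) - (v.count j : ℤ)| ≤ C

/-- `ω` is finitely balanced: it is `C`-balanced for some natural number `C`. -/
def IsFinitelyBalanced {A : Type*} [DecidableEq A] (ω : ℕ → A) : Prop :=
  ∃ C : ℕ, IsBalanced C ω

/-- The Brun substitution `β_{ij} : j ↦ ij, k ↦ k` for `k ≠ j` (used for `i ≠ j` only). -/
def beta {A : Type*} [DecidableEq A] (i j : A) : Substitution A :=
  fun k => if k = j then [i, j] else [k]

/-- The directive sequences of Brun words: every `σₙ` is some `β_{ij}`, every two consecutive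
terms are `β_{ij} β_{ij}` or `β_{ij} β_{jk}` (where `k = i` is allowed), and for each letter `i`
some `β_{ij}` occurs infinitely often. -/
structure IsBrunDirective {A : Type*} [DecidableEq A] (σ : ℕ → Substitution A) : Prop where
  mem : ∀ n, ∃ i j : A, i ≠ j ∧ σ n = beta i j
  admissible : ∀ n,
    (∃ i j : A, i ≠ j ∧ σ n = beta i j ∧ σ (n + 1) = beta i j) ∨
    (∃ i j k : A, i ≠ j ∧ j ≠ k ∧ σ n = beta i j ∧ σ (n + 1) = beta j k)
  recurrent : ∀ i : A, ∃ j : A, i ≠ j ∧ ∃ᶠ n in Filter.atTop, σ n = beta i j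

/-- A Brun word is a limit word of a Brun directive sequence. -/
def IsBrunWord {A : Type*} [DecidableEq A] [Inhabited A] (ω : ℕ → A) : Prop :=
  ∃ σ : ℕ → Substitution A, IsBrunDirective σ ∧ IsLimitWord σ ω

/-! Three letters. The letters `1, 2, 3` are the elements `0, 1, 2` of `Fin 3`. -/

/-- `ζ₁ : 1 ↦ 1, 2 ↦ 2, 3 ↦ 23`. -/
def zeta1 : Substitution (Fin 3) := ![[0], [1], [1, 2]]

/-- `ζ₂ : 1 ↦ 1, 2 ↦ 3, 3 ↦ 32`. -/
def zeta2 : Substitution (Fin 3) := ![[0], [2], [2, 1]]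

/-- `ζ₃ : 1 ↦ 2, 2 ↦ 3, 3 ↦ 31`. -/
def zeta3 : Substitution (Fin 3) := ![[1], [2], [2, 0]]

/-- `s` is the recoding `(σ̃ₙ)` of the sequence `σ` of Brun substitutions: `σ̃₀ = ζ₁`, and
`σ̃ₙ₊₁` is `ζ₁`, `ζ₂` or `ζ₃` according to whether `σₙ σₙ₊₁` is `β_{ij} β_{ij}`,
`β_{ij} β_{ji}` or `β_{ij} β_{jk}` with `{i, j, k} = {1, 2, 3}`. -/
structure IsRecoding (σ s : ℕ → Substitution (Fin 3)) : Prop where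
  zero : s 0 = zeta1
  same : ∀ n, ∀ i j : Fin 3, i ≠ j →
    σ n = beta i j → σ (n + 1) = beta i j → s (n + 1) = zeta1
  swap : ∀ n, ∀ i j : Fin 3, i ≠ j →
    σ n = beta i j → σ (n + 1) = beta j i → s (n + 1) = zeta2
  next : ∀ n, ∀ i j k : Fin 3, i ≠ j → j ≠ k → i ≠ k →
    σ n = beta i j → σ (n + 1) = beta j k → s (n + 1) = zeta3

/-- `τ_j = ζ₁^j ζ₂ ζ₁ ζ₃² ζ₁`, as a finite sequence of substitutions. -/
def tau (j : ℕ) : List (Substitution (Fin 3)) :=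
  List.replicate j zeta1 ++ [zeta2, zeta1, zeta3, zeta3, zeta1]

/-- `ρ_c = τ_{c-1} τ_{c-2} ⋯ τ₁ τ₀`, as a finite sequence of substitutions. -/
def rho (c : ℕ) : List (Substitution (Fin 3)) :=
  (List.range c).reverse.flatMap tau

/-- The directive sequence `ρ_{c₀} ρ_{c₁} ρ_{c₂} ⋯` (for positive `c_k`). -/
def rhoSeq (c : ℕ → ℕ) : ℕ → Substitution (Fin 3) :=
  infConcat (fun k => rho (c k))

end Brun

/-! Uniqueness: the block `tau 0` recurs in the sequence, and under its composition all three
letters have images of length at least 3 with the same first letter. Hence first letters and ever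
longer prefixes of a limit word are forced (`existsUnique_isLimitWord`). Each ζ is β₂₃ followed by a
permutation of the letters; pushing these permutations along the sequence turns it into a Brun
directive sequence, and conversely every σ with the given recoding is such a relabelling. So
existence, uniqueness and imbalance pass between the two sides.

Imbalance: `HasPair A` asks for factors with difference A e₁ - (A+1) e₂. Applying τ_j with j ≥ A+2
and trimming the ends yields such a pair for A+1 (`HasPair.tau`), so ρ_c creates a pair of size c-2.
This pair lies in the word at level k, and the substitutions before it could shrink it. Their
matrices are invertible, with inverses bounded by 3^N in the ℓ¹-norm (`norm1_le_flatMap_rho`), so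
C-balance of the limit word forces A ≤ 12·C·3^N (`IsBalanced.hasPair_le`). At k = C+1 the growth of
c_k contradicts this. -/

namespace Brun

/-! ### Prefixes and factors of infinite words -/

section Words

variable {A : Type*}

/-- The prefix of length `n` of the infinite word `w`. -/
def pre (w : ℕ → A) (n : ℕ) : List A := (List.range n).map w

@[simp] lemma length_pre (w : ℕ → A) (n : ℕ) : (pre w n).length = n := by simp [pre]

lemma pre_add (w : ℕ → A) (m n : ℕ) :
    pre w (m + n) = pre w m ++ (List.range n).map (fun i => w (m + i)) := by
  simp [pre, List.range_add]

lemma pre_succ (w : ℕ → A) (n : ℕ) : pre w (n + 1) = pre w n ++ [w n] := by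
  simp [pre, List.range_succ]

/-- The finite word `u` is a prefix of the infinite word `w`. -/
def IsInit (u : List A) (w : ℕ → A) : Prop := ∀ i, ∀ h : i < u.length, u[i] = w i

lemma isInit_pre (w : ℕ → A) (n : ℕ) : IsInit (pre w n) w := by
  intro i h
  simp [pre]

lemma IsInit.eq_pre {u : List A} {w : ℕ → A} (h : IsInit u w) : u = pre w u.length := by
  apply List.ext_getElem (by simp)
  intro i h1 h2
  rw [h i h1, isInit_pre w _ i h2]

lemma IsInit.of_prefix {u v : List A} {w : ℕ → A} (hv : IsInit v w) (huv : u <+: v) :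
    IsInit u w := by
  intro i h
  rw [huv.getElem h, hv]

lemma pre_prefix (w : ℕ → A) {m n : ℕ} (h : m ≤ n) : pre w m <+: pre w n := by
  obtain ⟨k, rfl⟩ := Nat.exists_eq_add_of_le h
  rw [pre_add]
  exact List.prefix_append _ _

lemma IsInit.prefix {u v : List A} {w : ℕ → A} (hu : IsInit u w) (hv : IsInit v w)
    (h : u.length ≤ v.length) : u <+: v := by
  rw [hu.eq_pre, hv.eq_pre]
  exact pre_prefix w h

lemma eq_of_isInit {w w' : ℕ → A}
    (h : ∀ n, ∃ u : List A, n ≤ u.length ∧ IsInit u w ∧ IsInit u w') : w = w' := by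
  funext n
  obtain ⟨u, hn, h1, h2⟩ := h (n + 1)
  rw [← h1 n hn, h2 n hn]

lemma exists_isInit_of_chain (P : ℕ → List A) (hP : ∀ k, P k <+: P (k + 1))
    (hl : ∀ n, ∃ k, n ≤ (P k).length) : ∃ w : ℕ → A, ∀ k, IsInit (P k) w := by
  have mono : ∀ k j, P k <+: P (k + j) := by
    intro k j
    induction j with
    | zero => exact List.prefix_rfl
    | succ j ih => exact ih.trans (hP _)
  choose K hK using fun n => hl (n + 1)
  refine ⟨fun n => (P (K n))[n]'(hK n), ?_⟩
  intro k i hi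
  rcases le_total k (K i) with h | h
  · obtain ⟨j, hj⟩ := Nat.exists_eq_add_of_le h
    have := mono k j
    rw [← hj] at this
    exact this.getElem hi
  · obtain ⟨j, hj⟩ := Nat.exists_eq_add_of_le h
    have := mono (K i) j
    rw [← hj] at this
    exact (this.getElem (hK i)).symm

lemma isFactor_iff {u : List A} {w : ℕ → A} :
    IsFactor u w ↔ ∃ x : List A, IsInit (x ++ u) w := by
  constructor
  · rintro ⟨k, n, rfl⟩
    refine ⟨pre w k, ?_⟩
    rw [← pre_add]
    exact isInit_pre _ _
  · rintro ⟨x, h⟩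
    refine ⟨x.length, u.length, ?_⟩
    have h1 := h.eq_pre
    rw [List.length_append, pre_add] at h1
    exact (List.append_inj h1 (by simp)).2

lemma IsFactor.of_append_left {u v : List A} {w : ℕ → A} (h : IsFactor (u ++ v) w) :
    IsFactor u w := by
  rw [isFactor_iff] at h ⊢
  obtain ⟨x, h⟩ := h
  exact ⟨x, h.of_prefix ⟨v, by simp⟩⟩

lemma IsFactor.of_append_right {u v : List A} {w : ℕ → A} (h : IsFactor (u ++ v) w) :
    IsFactor v w := by
  rw [isFactor_iff] at h ⊢
  obtain ⟨x, h⟩ := h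
  exact ⟨x ++ u, by simpa using h⟩

lemma IsFactor.exists_append {u : List A} {w : ℕ → A} (h : IsFactor u w) :
    ∃ a, IsFactor (u ++ [a]) w := by
  rw [isFactor_iff] at h
  obtain ⟨x, h⟩ := h
  refine ⟨w (x ++ u).length, isFactor_iff.2 ⟨x, ?_⟩⟩
  rw [← List.append_assoc]
  conv => rw [h.eq_pre]
  rw [length_pre, ← pre_succ]
  exact isInit_pre _ _

lemma isFactor_pre (w : ℕ → A) (n : ℕ) : IsFactor (pre w n) w :=
  isFactor_iff.2 ⟨[], isInit_pre w n⟩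

end Words

/-! ### Images under substitutions and uniqueness of limit words -/

section Images

variable {A : Type*}

lemma length_le_length_flatMap {B : Type*} {σ : A → List B} (hσ : ∀ a, σ a ≠ []) (u : List A) :
    u.length ≤ (u.flatMap σ).length := by
  induction u with
  | nil => simp
  | cons a u ih =>
    have := List.length_pos_iff.2 (hσ a)
    simp only [List.length_cons, List.flatMap_cons, List.length_append]
    omega

lemma flatMap_prefix {B : Type*} (σ : A → List B) {u v : List A} (h : u <+: v) :
    u.flatMap σ <+: v.flatMap σ := by
  obtain ⟨t, rfl⟩ := h
  exact ⟨t.flatMap σ, by simp⟩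

lemma isInit_infConcat [Inhabited A] {L : ℕ → List A} (hL : ∀ n, L n ≠ []) (n : ℕ) :
    IsInit ((List.range n).flatMap L) (infConcat L) := by
  intro i hi
  have hi' : i < ((List.range (i + 1)).flatMap L).length := by
    have := length_le_length_flatMap hL (List.range (i + 1))
    simp only [List.length_range] at this
    omega
  have mono : ∀ m m', m ≤ m' → (List.range m).flatMap L <+: (List.range m').flatMap L := by
    intro m m' h
    apply flatMap_prefix
    obtain ⟨k, rfl⟩ := Nat.exists_eq_add_of_le h
    rw [List.range_add]
    exact List.prefix_append _ _
  rw [infConcat, List.getD_eq_getElem _ _ hi']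
  rcases le_total n (i + 1) with h | h
  · exact (mono _ _ h).getElem hi
  · exact ((mono _ _ h).getElem hi').symm

/-- The infinite word `w` is the image of `w'` under `σ`, in terms of prefixes. -/
def IsImage (σ : Substitution A) (w' w : ℕ → A) : Prop :=
  ∀ n, IsInit ((pre w' n).flatMap σ) w

lemma pre_flatMap (σ : Substitution A) (w : ℕ → A) (n : ℕ) :
    (pre w n).flatMap σ = (List.range n).flatMap (fun i => σ (w i)) := by
  simp [pre, List.flatMap_map]

lemma isImage_iff [Inhabited A] {σ : Substitution A} (hσ : ∀ a, σ a ≠ []) {w' w : ℕ → A} :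
    IsImage σ w' w ↔ w = σ.applyInf w' := by
  have key : IsImage σ w' (σ.applyInf w') := by
    intro n
    rw [pre_flatMap]
    exact isInit_infConcat (fun n => hσ _) n
  constructor
  · intro h
    apply eq_of_isInit
    intro n
    refine ⟨_, ?_, h n, key n⟩
    simpa using length_le_length_flatMap hσ (pre w' n)
  · rintro rfl
    exact key

lemma IsImage.isInit {σ : Substitution A} {w' w : ℕ → A} (h : IsImage σ w' w) {u : List A}
    (hu : IsInit u w') : IsInit (u.flatMap σ) w := by
  rw [hu.eq_pre]
  exact h _

lemma IsImage.isFactor {σ : Substitution A} {w' w : ℕ → A} (h : IsImage σ w' w) {u : List A}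
    (hu : IsFactor u w') : IsFactor (u.flatMap σ) w := by
  rw [isFactor_iff] at hu ⊢
  obtain ⟨x, hx⟩ := hu
  exact ⟨x.flatMap σ, by simpa using h.isInit hx⟩

/-- The composition `σ₀ ∘ σ₁ ∘ ⋯` of a finite sequence of substitutions. -/
def comp : List (Substitution A) → Substitution A
  | [] => fun a => [a]
  | σ :: l => fun a => (comp l a).flatMap σ

lemma comp_append (l l' : List (Substitution A)) (a : A) :
    comp (l ++ l') a = (comp l' a).flatMap (comp l) := by
  induction l with
  | nil => simp [comp]
  | cons σ l ih => simp [comp, ih, List.flatMap_assoc]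

lemma comp_ne_nil {l : List (Substitution A)} (h : ∀ σ ∈ l, ∀ a, σ a ≠ []) (a : A) :
    comp l a ≠ [] := by
  induction l with
  | nil => simp [comp]
  | cons σ l ih =>
    have h1 := ih (fun τ hτ => h τ (List.mem_cons_of_mem _ hτ))
    have h2 := length_le_length_flatMap (h σ List.mem_cons_self) (comp l a)
    rw [← List.length_pos_iff] at h1 ⊢
    exact h1.trans_le h2

lemma IsImage.comp {l : List (Substitution A)} {s : ℕ → Substitution A} {W : ℕ → ℕ → A}
    (hW : ∀ n, IsImage (s n) (W (n + 1)) (W n)) (n : ℕ)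
    (hl : ∀ i (h : i < l.length), s (n + i) = l[i]) :
    IsImage (comp l) (W (n + l.length)) (W n) := by
  induction l generalizing n with
  | nil =>
    intro m
    simpa [Brun.comp] using isInit_pre (W n) m
  | cons σ l ih =>
    intro m
    have h1 := ih (n + 1) (fun i h => by
      have := hl (i + 1) (by simpa using h)
      simpa [add_assoc, add_comm 1] using this) m
    have h2 := (hW n).isInit h1
    have h3 : s n = σ := hl 0 (by simp)
    rw [h3, List.flatMap_assoc] at h2
    simpa [Brun.comp, add_assoc, add_comm 1] using h2

/-- The composition `sₙ ∘ sₙ₊₁ ∘ ⋯ ∘ sₙ₊ₖ₋₁`. -/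
def seg (s : ℕ → Substitution A) (n k : ℕ) : Substitution A :=
  Brun.comp ((List.range k).map fun i => s (n + i))

lemma seg_succ_left (s : ℕ → Substitution A) (n k : ℕ) (a : A) :
    seg s n (k + 1) a = (seg s (n + 1) k a).flatMap (s n) := by
  simp only [seg, List.range_succ_eq_map, List.map_cons, Brun.comp, List.map_map]
  simp [Function.comp_def, add_assoc, add_comm 1]

lemma seg_add (s : ℕ → Substitution A) (n j k : ℕ) (a : A) :
    seg s n (j + k) a = (seg s (n + j) k a).flatMap (seg s n j) := by
  simp only [seg, List.range_add, List.map_append, comp_append, List.map_map]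
  simp [Function.comp_def, add_assoc]

lemma seg_succ (s : ℕ → Substitution A) (n k : ℕ) (a : A) :
    seg s n (k + 1) a = (s (n + k) a).flatMap (seg s n k) := by
  rw [seg_add]
  simp [seg, Brun.comp]

lemma seg_ne_nil {s : ℕ → Substitution A} (hs : ∀ n a, s n a ≠ []) (n k : ℕ) (a : A) :
    seg s n k a ≠ [] := by
  apply comp_ne_nil
  simp only [List.mem_map]
  rintro σ ⟨i, -, rfl⟩
  exact hs _

lemma IsImage.seg {s : ℕ → Substitution A} {W : ℕ → ℕ → A}
    (hW : ∀ n, IsImage (s n) (W (n + 1)) (W n)) (n k : ℕ) :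
    IsImage (seg s n k) (W (n + k)) (W n) := by
  have := IsImage.comp (l := (List.range k).map fun i => s (n + i)) hW n (by simp)
  rwa [List.length_map, List.length_range] at this

lemma isLimitWord_iff [Inhabited A] {s : ℕ → Substitution A} (hs : ∀ n a, s n a ≠ [])
    {ω : ℕ → A} : IsLimitWord s ω ↔
      ∃ W : ℕ → ℕ → A, W 0 = ω ∧ ∀ n, IsImage (s n) (W (n + 1)) (W n) := by
  simp only [IsLimitWord, isImage_iff (hs _)]

lemma head?_flatMap_of_head? {B : Type*} {σ : A → List B} (hσ : ∀ a, σ a ≠ []) {u : List A} {a : A}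
    (hu : u.head? = some a) : (u.flatMap σ).head? = (σ a).head? := by
  obtain ⟨t, rfl⟩ : ∃ t, u = a :: t := by
    cases u with
    | nil => simp at hu
    | cons b t => simp at hu; exact ⟨t, by rw [hu]⟩
  rw [List.flatMap_cons, List.head?_append_of_ne_nil _ (hσ a)]

/-- A directive sequence in which blocks with long images and a common first letter of the images
recur has exactly one limit word. -/
theorem existsUnique_isLimitWord [Inhabited A] {s : ℕ → Substitution A} (hs : ∀ n a, s n a ≠ [])
    (h : ∀ n, ∃ p ≥ n, ∃ k, ∃ l, ∀ a, (seg s p k a).head? = some l ∧ 2 ≤ (seg s p k a).length) :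
    ∃! ω : ℕ → A, IsLimitWord s ω := by
  -- Each further recurring block gains a letter: its images have at least two letters, the first
  -- already accounts for N, and the second is not erased.
  have long : ∀ n N, ∃ K, ∀ k ≥ K, ∀ a, N ≤ (seg s n k a).length := by
    intro n N
    induction N with
    | zero => exact ⟨0, by simp⟩
    | succ N ih =>
      obtain ⟨K, hK⟩ := ih
      obtain ⟨p, hp, k, l, hk⟩ := h (n + K)
      obtain ⟨q, rfl⟩ := Nat.exists_eq_add_of_le (le_trans (Nat.le_add_right n K) hp)
      have base : ∀ a, N + 1 ≤ (seg s n (q + k) a).length := by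
        intro a
        rw [seg_add]
        obtain ⟨x, y, t, hx⟩ : ∃ x y t, seg s (n + q) k a = x :: y :: t := by
          have h2 := (hk a).2
          match seg s (n + q) k a, h2 with
          | x :: y :: t, _ => exact ⟨x, y, t, rfl⟩
        have h1 := hK q (by omega) x
        have h2 := List.length_pos_iff.2 (seg_ne_nil hs n q y)
        simp only [hx, List.flatMap_cons, List.length_append]
        omega
      refine ⟨q + k, fun m hm a => ?_⟩
      obtain ⟨r, rfl⟩ := Nat.exists_eq_add_of_le hm
      rw [seg_add]
      obtain ⟨x, t, hx⟩ := List.exists_cons_of_ne_nil (seg_ne_nil hs (n + (q + k)) r a)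
      have := base x
      simp only [hx, List.flatMap_cons, List.length_append]
      omega
  have first : ∀ n, ∃ l, ∃ K, ∀ k ≥ K, ∀ a, (seg s n k a).head? = some l := by
    intro n
    obtain ⟨p, hp, k, l, hk⟩ := h n
    obtain ⟨q, rfl⟩ := Nat.exists_eq_add_of_le hp
    obtain ⟨x, t, hx⟩ := List.exists_cons_of_ne_nil (seg_ne_nil hs n q l)
    have base : ∀ a, (seg s n (q + k) a).head? = some x := by
      intro a
      rw [seg_add, head?_flatMap_of_head? (seg_ne_nil hs n q) (hk a).1, hx, List.head?_cons]
    refine ⟨x, q + k, fun m hm a => ?_⟩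
    obtain ⟨r, rfl⟩ := Nat.exists_eq_add_of_le hm
    obtain ⟨y, u, hy⟩ := List.exists_cons_of_ne_nil (seg_ne_nil hs (n + (q + k)) r a)
    rw [seg_add, head?_flatMap_of_head? (seg_ne_nil hs n _) (a := y) (by rw [hy]; rfl), base]
  choose l K hl using first
  -- The eventual first letters are compatible with the substitutions, so the words `seg s n k (l (n
  -- + k))` extend one another.
  have hstep : ∀ n, (s n (l (n + 1))).head? = some (l n) := by
    intro n
    set k := max (K n) (K (n + 1))
    have h1 := hl n (k + 1) ((le_max_left _ _).trans (Nat.le_succ _)) (l 0)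
    have h2 := hl (n + 1) k (le_max_right _ _) (l 0)
    rwa [seg_succ_left, head?_flatMap_of_head? (hs n) h2] at h1
  have chain : ∀ n k, seg s n k (l (n + k)) <+: seg s n (k + 1) (l (n + (k + 1))) := by
    intro n k
    rw [seg_succ]
    have h1 := hstep (n + k)
    obtain ⟨x, t, hx⟩ := List.exists_cons_of_ne_nil (hs (n + k) (l (n + k + 1)))
    rw [hx] at h1
    simp only [List.head?_cons, Option.some.injEq] at h1
    rw [← add_assoc, hx, h1, List.flatMap_cons]
    exact List.prefix_append _ _
  have ex : ∀ n, ∃ w : ℕ → A, ∀ k, IsInit (seg s n k (l (n + k))) w := by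
    intro n
    apply exists_isInit_of_chain _ (chain n)
    intro N
    obtain ⟨k, hk⟩ := long n N
    exact ⟨k, hk k le_rfl _⟩
  choose W hW using ex
  refine ⟨W 0, (isLimitWord_iff hs).2 ⟨W, rfl, fun n m => ?_⟩, ?_⟩
  · obtain ⟨k, hk⟩ := long (n + 1) m
    have h1 : pre (W (n + 1)) m <+: seg s (n + 1) k (l (n + 1 + k)) :=
      (isInit_pre _ _).prefix (hW (n + 1) k) (by simpa using hk k le_rfl _)
    have h2 := flatMap_prefix (s n) h1
    rw [← seg_succ_left] at h2
    refine (hW n (k + 1)).of_prefix ?_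
    rwa [show n + (k + 1) = n + 1 + k by omega]
  · intro ω hω
    obtain ⟨V, rfl, hV⟩ := (isLimitWord_iff hs).1 hω
    have hV0 : ∀ n k, IsInit (seg s n k (V (n + k) 0)) (V n) := by
      intro n k
      have := IsImage.seg hV n k 1
      simpa [pre] using this
    -- Any limit word has these first letters at every level, hence the same prefixes as `W 0`.
    have hV1 : ∀ n, V n 0 = l n := by
      intro n
      have h1 := hl n (K n) le_rfl (V (n + K n) 0)
      have h2 := hV0 n (K n) 0 (List.length_pos_iff.2 (seg_ne_nil hs _ _ _))
      rw [List.head?_eq_getElem?, List.getElem?_eq_getElem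
        (List.length_pos_iff.2 (seg_ne_nil hs _ _ _)), Option.some.injEq] at h1
      rw [← h2, h1]
    apply eq_of_isInit
    intro N
    obtain ⟨k, hk⟩ := long 0 N
    refine ⟨_, hk k le_rfl (l (0 + k)), ?_, hW 0 k⟩
    rw [← hV1]
    exact hV0 0 k

end Images

/-! ### Relabelling -/

lemma pre_comp {A : Type*} (f : A → A) (w : ℕ → A) (n : ℕ) :
    pre (fun i => f (w i)) n = (pre w n).map f := by
  simp [pre, Function.comp_def]

lemma IsInit.map {A : Type*} {u : List A} {w : ℕ → A} (h : IsInit u w) (f : A → A) :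
    IsInit (u.map f) (fun i => f (w i)) := by
  intro i hi
  simp [h i (by simpa using hi)]

/-- The bijections `P n` transport the directive sequence `s` to the directive sequence `σ`. -/
def IsRelabelling {A : Type*} (P : ℕ → Equiv.Perm A) (s σ : ℕ → Substitution A) : Prop :=
  ∀ n a, σ n (P (n + 1) a) = (s n a).map (P n)

section Relabelling

variable {A : Type*} {P : ℕ → Equiv.Perm A} {s σ : ℕ → Substitution A}

lemma IsRelabelling.symm (h : IsRelabelling P s σ) :
    IsRelabelling (fun n => (P n).symm) σ s := by
  intro n a
  have := h n ((P (n + 1)).symm a)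
  rw [Equiv.apply_symm_apply] at this
  rw [this]
  simp

lemma IsRelabelling.isLimitWord [Inhabited A] (h : IsRelabelling P s σ) (hs : ∀ n a, s n a ≠ [])
    {ω : ℕ → A} (hω : IsLimitWord s ω) : IsLimitWord σ (fun i => P 0 (ω i)) := by
  have hσ : ∀ n a, σ n a ≠ [] := by
    intro n a
    have := h n ((P (n + 1)).symm a)
    rw [Equiv.apply_symm_apply] at this
    rw [this]
    simpa using hs n _
  obtain ⟨W, rfl, hW⟩ := (isLimitWord_iff hs).1 hω
  refine (isLimitWord_iff hσ).2 ⟨fun n i => P n (W n i), rfl, fun n m => ?_⟩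
  have h1 := (hW n m).map (P n)
  rw [pre_comp, List.flatMap_map]
  simp only [h n]
  rwa [List.map_flatMap] at h1

lemma IsFinitelyBalanced.map [DecidableEq A] {ω : ℕ → A} (h : IsFinitelyBalanced ω)
    (f : Equiv.Perm A) : IsFinitelyBalanced (fun i => f (ω i)) := by
  obtain ⟨C, hC⟩ := h
  refine ⟨C, ?_⟩
  rintro u v ⟨k, n, rfl⟩ ⟨k', n', rfl⟩ hl j
  have h1 := hC _ _ ⟨k, n, rfl⟩ ⟨k', n', rfl⟩ (by simpa using hl) (f.symm j)
  have h2 : ∀ k n, ((List.range n).map fun m => f (ω (k + m))).count j =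
      ((List.range n).map fun m => ω (k + m)).count (f.symm j) := by
    intro k n
    have := List.count_map_of_injective ((List.range n).map fun m => ω (k + m)) f f.injective
      (f.symm j)
    rwa [List.map_map, Equiv.apply_symm_apply] at this
  rwa [h2, h2]

end Relabelling

/-- The permutation `π` with `ζ = π ∘ β₂₃`, for `ζ` among `ζ₁, ζ₂, ζ₃`. -/
def permOf (ζ : Substitution (Fin 3)) : Equiv.Perm (Fin 3) :=
  if ζ = zeta1 then 1 else if ζ = zeta2 then Equiv.swap 1 2 else finRotate 3

/-- `ζ` is one of `ζ₁, ζ₂, ζ₃`. -/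
def IsZeta (ζ : Substitution (Fin 3)) : Prop := ζ = zeta1 ∨ ζ = zeta2 ∨ ζ = zeta3

lemma permOf_zeta1 : permOf zeta1 = 1 := by decide

lemma permOf_zeta2 : permOf zeta2 = Equiv.swap 1 2 := by decide

lemma permOf_zeta3 : permOf zeta3 = finRotate 3 := by decide

lemma IsZeta.eq_map {ζ : Substitution (Fin 3)} (h : IsZeta ζ) (a : Fin 3) :
    ζ a = (beta 1 2 a).map (permOf ζ) := by
  rcases h with rfl | rfl | rfl <;> revert a <;> decide

lemma IsZeta.ne_nil {ζ : Substitution (Fin 3)} (h : IsZeta ζ) (a : Fin 3) : ζ a ≠ [] := by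
  rcases h with rfl | rfl | rfl <;> revert a <;> decide

lemma beta_perm {A : Type*} [DecidableEq A] (π : Equiv.Perm A) (i j a : A) :
    beta (π i) (π j) (π a) = (beta i j a).map π := by
  simp only [beta, π.injective.eq_iff]
  split <;> rfl

lemma beta_injective : ∀ i j k l : Fin 3, i ≠ j → k ≠ l → beta i j = beta k l →
    i = k ∧ j = l := by
  decide

lemma exists_perm_of_ne : ∀ i j : Fin 3, i ≠ j → ∃ π : Equiv.Perm (Fin 3), π 1 = i ∧ π 2 = j := by
  decide

lemma perm_eq_of_apply : ∀ π π' : Equiv.Perm (Fin 3), π 1 = π' 1 → π 2 = π' 2 → π = π' := by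
  decide

lemma isRelabelling_of_mul {P : ℕ → Equiv.Perm (Fin 3)} {s : ℕ → Substitution (Fin 3)}
    (hs : ∀ n, IsZeta (s n)) (hP : ∀ n, P (n + 1) = P n * permOf (s n)) :
    IsRelabelling P s (fun n => beta (P (n + 1) 1) (P (n + 1) 2)) := by
  intro n a
  simp only
  rw [beta_perm, (hs n).eq_map, List.map_map, hP]
  rfl

/-- Every recoded Brun sequence arises by relabelling. -/
theorem IsRecoding.exists_isRelabelling {σ s : ℕ → Substitution (Fin 3)}
    (hσ : IsBrunDirective σ) (h : IsRecoding σ s) : ∃ P, IsRelabelling P s σ := by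
  have ex : ∀ n, ∃ π : Equiv.Perm (Fin 3), σ n = beta (π 1) (π 2) := by
    intro n
    obtain ⟨i, j, hij, hn⟩ := hσ.mem n
    obtain ⟨π, rfl, rfl⟩ := exists_perm_of_ne i j hij
    exact ⟨π, hn⟩
  choose Q hQ using ex
  have hne : ∀ n, Q n 1 ≠ Q n 2 := fun n => (Q n).injective.ne (by decide)
  have step : ∀ n, IsZeta (s (n + 1)) ∧ Q (n + 1) = Q n * permOf (s (n + 1)) := by
    intro n
    rcases hσ.admissible n with ⟨i, j, hij, h0, h1⟩ | ⟨i, j, k, hij, hjk, h0, h1⟩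
    · obtain ⟨e1, e2⟩ := beta_injective _ _ _ _ (hne n) hij ((hQ n).symm.trans h0)
      obtain ⟨e3, e4⟩ := beta_injective _ _ _ _ (hne (n + 1)) hij ((hQ (n + 1)).symm.trans h1)
      have e := h.same n i j hij h0 h1
      refine ⟨Or.inl e, ?_⟩
      rw [e, permOf_zeta1, mul_one]
      exact perm_eq_of_apply _ _ (e3.trans e1.symm) (e4.trans e2.symm)
    · obtain ⟨e1, e2⟩ := beta_injective _ _ _ _ (hne n) hij ((hQ n).symm.trans h0)
      obtain ⟨e3, e4⟩ := beta_injective _ _ _ _ (hne (n + 1)) hjk ((hQ (n + 1)).symm.trans h1)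
      by_cases hik : i = k
      · subst hik
        have e := h.swap n i j hij h0 h1
        refine ⟨Or.inr (Or.inl e), ?_⟩
        rw [e, permOf_zeta2]
        apply perm_eq_of_apply
        · simpa using e3.trans e2.symm
        · simpa using e4.trans e1.symm
      · have e := h.next n i j k hij hjk hik h0 h1
        refine ⟨Or.inr (Or.inr e), ?_⟩
        rw [e, permOf_zeta3]
        have key : ∀ π π' : Equiv.Perm (Fin 3), π' 1 = π 2 → π' 2 ≠ π 1 →
          π' = π * finRotate 3 := by decide
        apply key _ _ (e3.trans e2.symm)
        rw [e4, e1]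
        exact Ne.symm hik
  have hz : ∀ n, IsZeta (s n) := by
    rintro (_ | n)
    · exact Or.inl h.zero
    · exact (step n).1
  -- The shift reflects that `s (n + 1)` compares `σ n` with `σ (n + 1)`. At `n = 0` the truncated
  -- subtraction gives `Q 0` twice, which fits because `s 0` is ζ₁, with trivial permutation.
  refine ⟨fun n => Q (n - 1), ?_⟩
  have hrel := isRelabelling_of_mul (P := fun n => Q (n - 1)) hz (by
    rintro (_ | n)
    · simp [h.zero, permOf_zeta1]
    · exact (step n).2)
  intro n a
  rw [hQ n]
  exact hrel n a

/-- Limit words of sequences of `ζ₁, ζ₂, ζ₃` in which `ζ₂ζ₁ζ₃ζ₃ζ₁` recurs are Brun words. -/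
theorem isBrunWord_of_isLimitWord {s : ℕ → Substitution (Fin 3)} (hs : ∀ n, IsZeta (s n))
    (hrec : ∀ n, ∃ p ≥ n, ∀ i (h : i < (tau 0).length), s (p + i) = (tau 0)[i])
    {ω : ℕ → Fin 3} (hω : IsLimitWord s ω) : IsBrunWord ω := by
  obtain ⟨P, hP0, hP⟩ : ∃ P : ℕ → Equiv.Perm (Fin 3), P 0 = 1 ∧
      ∀ n, P (n + 1) = P n * permOf (s n) :=
    ⟨fun n => Nat.rec 1 (fun n π => π * permOf (s n)) n, rfl, fun n => rfl⟩
  have hne : ∀ n, P n 1 ≠ P n 2 := fun n => (P n).injective.ne (by decide)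
  have hrel := isRelabelling_of_mul hs hP
  refine ⟨_, ⟨fun n => ⟨_, _, hne (n + 1), rfl⟩, fun n => ?_, fun i => ?_⟩,
    by simpa [hP0] using hrel.isLimitWord (fun n => (hs n).ne_nil) hω⟩
  · rcases hs (n + 1) with e | e | e
    · left
      refine ⟨_, _, hne (n + 1), rfl, ?_⟩
      rw [hP (n + 1), e, permOf_zeta1, mul_one]
    · right
      refine ⟨_, _, P (n + 2) 2, hne (n + 1), ?_, rfl, ?_⟩ <;>
        rw [hP (n + 1), e, permOf_zeta2]
      · simp
      · simp
    · right
      refine ⟨_, _, P (n + 2) 2, hne (n + 1), ?_, rfl, ?_⟩ <;>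
        rw [hP (n + 1), e, permOf_zeta3]
      · exact (P (n + 1)).injective.ne (by decide)
      · rfl
  -- Within one occurrence of `tau 0` at `p`, the first index of β takes the values `P p 2`, `P p 1`
  -- and `P p 0`, so every letter `i` appears. The second index may vary; finiteness of the alphabet
  -- then fixes one `j` that recurs.
  · have hfreq : ∃ᶠ n in Filter.atTop, ∃ j, i ≠ j ∧
        beta (P (n + 1) 1) (P (n + 1) 2) = beta i j := by
      rw [Filter.frequently_atTop]
      intro N
      obtain ⟨p, hp, hτ⟩ := hrec N
      have e0 : s p = zeta2 := hτ 0 (by decide)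
      have e1 : s (p + 1) = zeta1 := hτ 1 (by decide)
      have e2 : s (p + 2) = zeta3 := hτ 2 (by decide)
      have e3 : s (p + 3) = zeta3 := hτ 3 (by decide)
      have q0 : P (p + 1) 1 = P p 2 := by rw [hP, e0, permOf_zeta2]; rfl
      have q2 : P (p + 2 + 1) 1 = P p 1 := by
        rw [hP (p + 2), hP (p + 1), hP p, e0, e1, e2, permOf_zeta1, permOf_zeta2, permOf_zeta3]
        rfl
      have q3 : P (p + 3 + 1) 1 = P p 0 := by
        rw [hP (p + 3), hP (p + 2), hP (p + 1), hP p, e0, e1, e2, e3, permOf_zeta1, permOf_zeta2, permOf_zeta3]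
        rfl
      obtain ⟨a, rfl⟩ := (P p).surjective i
      fin_cases a
      · exact ⟨p + 3, by omega, _, q3 ▸ hne (p + 3 + 1), by simp only; rw [q3]; rfl⟩
      · exact ⟨p + 2, by omega, _, q2 ▸ hne (p + 2 + 1), by simp only; rw [q2]; rfl⟩
      · exact ⟨p, by omega, _, q0 ▸ hne (p + 1), by simp only; rw [q0]; rfl⟩
    by_contra hcon
    push Not at hcon
    have : ∀ᶠ n in Filter.atTop, ∀ j, i ≠ j → beta (P (n + 1) 1) (P (n + 1) 2) ≠ beta i j := by
      rw [Filter.eventually_all]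
      intro j
      by_cases hij : i = j
      · simp [hij]
      · simpa [hij] using hcon j hij
    obtain ⟨n, ⟨j, hij, hn⟩, h2⟩ := (hfreq.and_eventually this).exists
    exact h2 j hij hn

/-! ### Abelianization -/

/-- The numbers of occurrences of the letters in a finite word. -/
def ab (u : List (Fin 3)) (b : Fin 3) : ℤ := u.count b

/-- The linear map on `ℤ³` induced by a substitution. -/
def act (σ : Substitution (Fin 3)) (z : Fin 3 → ℤ) (b : Fin 3) : ℤ :=
  ∑ a, z a * ab (σ a) b

lemma ab_append (u v : List (Fin 3)) : ab (u ++ v) = ab u + ab v := by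
  funext b
  simp [ab]

lemma act_ab (σ : Substitution (Fin 3)) (u : List (Fin 3)) : act σ (ab u) = ab (u.flatMap σ) := by
  induction u with
  | nil => funext b; simp [act, ab]
  | cons a u ih =>
    rw [List.flatMap_cons, ab_append, ← ih]
    funext b
    fin_cases a <;> simp [act, ab, Fin.sum_univ_three] <;> ring

lemma act_add (σ : Substitution (Fin 3)) (y z : Fin 3 → ℤ) :
    act σ (y + z) = act σ y + act σ z := by
  funext b
  simp [act, add_mul, Finset.sum_add_distrib]

lemma act_smul (σ : Substitution (Fin 3)) (t : ℤ) (z : Fin 3 → ℤ) :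
    act σ (t • z) = t • act σ z := by
  funext b
  simp [act, Finset.mul_sum, mul_assoc]

lemma act_comp_append (l l' : List (Substitution (Fin 3))) (z : Fin 3 → ℤ) :
    act (comp (l ++ l')) z = act (comp l) (act (comp l') z) := by
  funext b
  have h : ∀ a, ab (comp (l ++ l') a) b = act (comp l) (ab (comp l' a)) b := by
    intro a
    rw [comp_append, act_ab]
  simp only [act, h, Finset.sum_mul, Finset.mul_sum]
  rw [Finset.sum_comm]
  simp only [mul_assoc]

/-- The `ℓ¹`-norm on `ℤ³`. -/
def norm1 (z : Fin 3 → ℤ) : ℤ := ∑ a, |z a|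

/-! ### The substitutions `τ_j` and `ρ_c` -/

lemma comp_replicate_zeta1 (j : ℕ) : comp (List.replicate j zeta1) =
    ![[0], [1], List.replicate j 1 ++ [2]] := by
  induction j with
  | zero => funext a; fin_cases a <;> rfl
  | succ j ih =>
    funext a
    rw [List.replicate_succ, comp, ih]
    have h : (List.replicate j (1 : Fin 3)).flatMap zeta1 = List.replicate j 1 := by
      rw [List.flatMap_replicate]
      simp [zeta1]
    fin_cases a
    · rfl
    · rfl
    · simp only [Fin.reduceFinMk, Matrix.cons_val, List.flatMap_append, h, List.replicate_succ']
      simp [zeta1]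

/-- The word `2ʲ3`. -/
def blk (j : ℕ) : List (Fin 3) := List.replicate j 1 ++ [2]

lemma comp_tau_zero : comp (tau 0) =
    ![[2, 2, 1], [2, 2, 1, 0], [2, 2, 1, 0, 2, 2, 1, 0, 2]] := by
  decide

/-- Since `tau j` is ζ₁ʲ followed by `tau 0`, these are the images under `tau 0` with each letter 3
replaced by 2ʲ3. -/
lemma comp_tau (j : ℕ) : comp (tau j) = ![blk j ++ blk j ++ [1], blk j ++ blk j ++ [1, 0],
    blk j ++ blk j ++ [1, 0] ++ blk j ++ blk j ++ [1, 0] ++ blk j] := by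
  have h : tau j = List.replicate j zeta1 ++ tau 0 := rfl
  funext a
  rw [h, comp_append, comp_tau_zero, comp_replicate_zeta1]
  fin_cases a <;> simp [blk]

lemma ab_blk (j : ℕ) : ab (blk j) = ![0, (j : ℤ), 1] := by
  funext b
  fin_cases b <;> simp [ab, blk, List.count_replicate]

lemma ab_one : ab [1] = ![0, 1, 0] := by decide

lemma ab_one_zero : ab [1, 0] = ![1, 1, 0] := by decide

lemma act_tau (j : ℕ) (z : Fin 3 → ℤ) : act (comp (tau j)) z =
    ![z 1 + 2 * z 2, (2 * j + 1) * (z 0 + z 1) + (5 * j + 2) * z 2,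
      2 * z 0 + 2 * z 1 + 5 * z 2] := by
  funext b
  simp only [act, Fin.sum_univ_three, comp_tau, Matrix.cons_val, ab_append, ab_blk, ab_one, ab_one_zero]
  fin_cases b <;> simp <;> ring

/-- The matrix of τ_j is inverted explicitly: `y 1 - j * y 2` recovers `z 0 + z 1 + 2 * z 2`, from
which each `z i` follows. The inverse has norm at most 7(j+1); the cruder power of 3 is used because
the exponents j+4, summed over j < c, give N(c). -/
lemma norm1_le_tau (j : ℕ) (z : Fin 3 → ℤ) :
    norm1 z ≤ 3 ^ (j + 4) * norm1 (act (comp (tau j)) z) := by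
  set y := act (comp (tau j)) z with hy
  rw [act_tau] at hy
  have h0 : y 0 = z 1 + 2 * z 2 := by rw [hy]; rfl
  have h1 : y 1 = (2 * j + 1) * (z 0 + z 1) + (5 * j + 2) * z 2 := by rw [hy]; rfl
  have h2 : y 2 = 2 * z 0 + 2 * z 1 + 5 * z 2 := by rw [hy]; rfl
  have hw : y 1 - j * y 2 = z 0 + z 1 + 2 * z 2 := by rw [h1, h2]; ring
  have hpow : (7 * (j + 1) : ℤ) ≤ 3 ^ (j + 4) := by
    have : (j : ℤ) + 1 ≤ 3 ^ j := by exact_mod_cast Nat.lt_pow_self (by norm_num : 1 < 3)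
    rw [pow_add]
    linarith
  have hn : 0 ≤ norm1 y := Finset.sum_nonneg fun _ _ => abs_nonneg _
  refine le_trans ?_ (mul_le_mul_of_nonneg_right hpow hn)
  simp only [norm1, Fin.sum_univ_three]
  have e0 : z 0 = (y 1 - j * y 2) - y 0 := by rw [hw, h0]; ring
  have e2 : z 2 = y 2 - 2 * (y 1 - j * y 2) := by rw [hw, h2]; ring
  have e1 : z 1 = y 0 - 2 * (y 2 - 2 * (y 1 - j * y 2)) := by rw [← e2, h0]; ring
  have hj : (0 : ℤ) ≤ j := Int.natCast_nonneg j
  have a0 := abs_nonneg (y 0)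
  have a1 := abs_nonneg (y 1)
  have a2 := abs_nonneg (y 2)
  have aw : |y 1 - j * y 2| ≤ |y 1| + j * |y 2| := by
    refine (abs_sub _ _).trans ?_
    rw [abs_mul, abs_of_nonneg hj]
  have b0 : |z 0| ≤ |y 1 - j * y 2| + |y 0| := by rw [e0]; exact abs_sub _ _
  have b2 : |z 2| ≤ |y 2| + 2 * |y 1 - j * y 2| := by
    rw [e2]
    refine (abs_sub _ _).trans ?_
    rw [abs_mul, abs_of_nonneg (by norm_num : (0 : ℤ) ≤ 2)]
  have b1 : |z 1| ≤ |y 0| + 2 * |z 2| := by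
    rw [e1, ← e2]
    refine (abs_sub _ _).trans ?_
    rw [abs_mul, abs_of_nonneg (by norm_num : (0 : ℤ) ≤ 2)]
  nlinarith [mul_nonneg hj a0, mul_nonneg hj a1, mul_nonneg hj a2]

lemma rho_succ (c : ℕ) : rho (c + 1) = tau c ++ rho c := by
  simp [rho, List.range_succ]

lemma norm1_le_rho (c : ℕ) (z : Fin 3 → ℤ) :
    norm1 z ≤ 3 ^ (c * (c + 1) / 2 + 3 * c) * norm1 (act (comp (rho c)) z) := by
  induction c generalizing z with
  | zero =>
    have : act (comp (rho 0)) z = z := by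
      funext b
      fin_cases b <;> simp [rho, act, comp, ab, Fin.sum_univ_three]
    simp [this]
  | succ c ih =>
    have e : (c + 1) * (c + 1 + 1) / 2 + 3 * (c + 1) = c * (c + 1) / 2 + 3 * c + (c + 4) := by
      have : (c + 1) * (c + 1 + 1) = c * (c + 1) + (c + 1) * 2 := by ring
      rw [this, Nat.add_mul_div_right _ _ (by norm_num)]
      ring
    rw [rho_succ, act_comp_append, e, pow_add, mul_assoc]
    exact (ih z).trans (mul_le_mul_of_nonneg_left (norm1_le_tau c _) (by positivity))

lemma norm1_le_flatMap_rho (c : ℕ → ℕ) (k : ℕ) (z : Fin 3 → ℤ) :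
    norm1 z ≤ 3 ^ (∑ i ∈ Finset.range k, (c i * (c i + 1) / 2 + 3 * c i)) *
      norm1 (act (comp ((List.range k).flatMap fun i => rho (c i))) z) := by
  induction k generalizing z with
  | zero =>
    have : act (comp []) z = z := by
      funext b
      fin_cases b <;> simp [act, comp, ab, Fin.sum_univ_three]
    simp [this]
  | succ k ih =>
    rw [List.range_succ, List.flatMap_append, act_comp_append, Finset.sum_range_succ, add_comm,
      pow_add, mul_assoc]
    simp only [List.flatMap_cons, List.flatMap_nil, List.append_nil]
    exact (norm1_le_rho (c k) z).trans
      (mul_le_mul_of_nonneg_left (ih _) (by positivity))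

/-! ### Unbalanced factors -/

/-- This prefix, common to all letters, is what `HasPair.tau` cuts off one image and uses to extend
the other, whatever letters occur there. -/
lemma comp_tau_eq_blk_append (j : ℕ) (a : Fin 3) :
    ∃ t, comp (tau j) a = blk j ++ blk j ++ [1] ++ t := by
  rw [comp_tau]
  fin_cases a
  · exact ⟨[], by simp⟩
  · exact ⟨[0], by simp⟩
  · exact ⟨[0] ++ blk j ++ blk j ++ [1, 0] ++ blk j, by simp⟩

/-- A word has a pair of factors `u, v` whose abelianizations differ by `A e₁ - (A + 1) e₂`. -/
def HasPair (A : ℕ) (w : ℕ → Fin 3) : Prop :=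
  ∃ u v, IsFactor u w ∧ IsFactor v w ∧ ab u - ab v = ![(A : ℤ), -(A + 1), 0]

/-- The matrix of τ_j sends (A, -(A+1), 0) to (-(A+1), -(2j+1), -2). Exchanging the two images flips
the sign; removing 2ʲ32ʲ32 from the front of the image of v cancels (0, 2j+1, 2), and appending
2^(A+2) to the image of u leaves (A+1, -(A+2), 0). -/
lemma HasPair.tau {A j : ℕ} (hj : A + 2 ≤ j) {w' w : ℕ → Fin 3} (h : IsImage (comp (tau j)) w' w)
    (hw : HasPair A w') : HasPair (A + 1) w := by
  obtain ⟨u, v, hu, hv, huv⟩ := hw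
  obtain ⟨b, v', rfl⟩ : ∃ b v', v = b :: v' := by
    cases v with
    | nil =>
      have := congrFun huv 1
      simp [ab] at this
      omega
    | cons b v' => exact ⟨b, v', rfl⟩
  obtain ⟨a, ha⟩ := hu.exists_append
  obtain ⟨t, ht⟩ := comp_tau_eq_blk_append j b
  obtain ⟨t', ht'⟩ := comp_tau_eq_blk_append j a
  have hv2 := h.isFactor hv
  have hu2 := h.isFactor ha
  have hact : act (comp (Brun.tau j)) (ab u - ab (b :: v')) =
      ab (u.flatMap (comp (Brun.tau j))) - ab ((b :: v').flatMap (comp (Brun.tau j))) := by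
    rw [sub_eq_add_neg, ← neg_one_smul ℤ, act_add, act_smul, act_ab, act_ab, neg_one_smul,
      sub_eq_add_neg]
  rw [huv, act_tau, List.flatMap_cons, ht, List.append_assoc, ab_append] at hact
  rw [List.flatMap_cons, ht, List.append_assoc] at hv2
  rw [List.flatMap_append, List.flatMap_cons, ht', List.flatMap_nil] at hu2
  refine ⟨_, u.flatMap (comp (Brun.tau j)) ++ List.replicate (A + 2) 1, hv2.of_append_right, ?_, ?_⟩
  · obtain ⟨r, rfl⟩ := Nat.exists_eq_add_of_le hj
    rw [blk, List.replicate_add] at hu2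
    simp only [← List.append_assoc] at hu2
    -- After the image of u, only the first A+2 letters of the image of the next letter `a` are
    -- kept; the other eight pieces are dropped.
    iterate 8 replace hu2 := hu2.of_append_left
    exact hu2
  · have hX : ab (blk j ++ blk j ++ [1]) = ![0, 2 * (j : ℤ) + 1, 2] := by
      rw [ab_append, ab_append, ab_blk]
      funext b
      fin_cases b <;> simp [ab]
      ring
    rw [hX] at hact
    rw [ab_append (u.flatMap _)]
    generalize ab (t ++ _) = p at hact ⊢
    generalize ab (u.flatMap _) = q at hact ⊢
    have hr : ab (List.replicate (A + 2) 1) = ![0, (A : ℤ) + 2, 0] := by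
      funext i
      fin_cases i <;> simp [ab, List.count_replicate]
    rw [hr]
    funext i
    have hi := congrFun hact i
    fin_cases i <;> simp [Matrix.vecHead, Matrix.vecTail] at hi ⊢ <;> linarith

/-- The image of a word under `ρ_c` contains an unbalanced pair of factors. -/
lemma hasPair_rho {l : List (Substitution (Fin 3))} {c : ℕ} (hl : l = rho (c + 2))
    {s : ℕ → Substitution (Fin 3)} {W : ℕ → ℕ → Fin 3}
    (hW : ∀ n, IsImage (s n) (W (n + 1)) (W n)) (n : ℕ)
    (h : ∀ i (h : i < l.length), s (n + i) = l[i]) : HasPair c (W n) := by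
  induction c generalizing n l with
  | zero =>
    have e : l = tau 1 ++ tau 0 := by rw [hl]; decide
    have h1 := IsImage.comp (l := tau 1) hW n (by
      intro i hi
      rw [h i (by rw [e, List.length_append]; omega)]
      simp only [e]
      rw [List.getElem_append_left])
    -- For A = 0 the empty word and the single letter 2 suffice; that letter occurs because images
    -- under τ₁ begin with 23.
    refine ⟨[], [1], ?_, ?_, ?_⟩
    · exact isFactor_pre _ 0
    · have h2 := h1.isFactor (isFactor_pre _ 1)
      obtain ⟨t, ht⟩ := comp_tau_eq_blk_append 1 (W (n + (tau 1).length) 0)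
      have : (pre (W (n + (tau 1).length)) 1).flatMap (comp (tau 1)) =
          [1] ++ ([2] ++ blk 1 ++ [1] ++ t) := by
        simp [pre, ht, blk]
      rw [this] at h2
      exact h2.of_append_left
    · funext b
      fin_cases b <;> simp [ab]
  | succ c ih =>
    have e : l = tau (c + 2) ++ rho (c + 2) := by rw [hl, ← rho_succ]
    have h1 := IsImage.comp (l := tau (c + 2)) hW n (by
      intro i hi
      rw [h i (by rw [e, List.length_append]; omega)]
      simp only [e]
      rw [List.getElem_append_left])
    refine HasPair.tau le_rfl h1 (ih rfl _ ?_)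
    intro i hi
    rw [add_assoc, h _ (by rw [e, List.length_append]; omega)]
    simp only [e]
    rw [List.getElem_append_right (by omega)]
    simp

/-! ### Balanced words -/

/-- The prefix splits into `j` factors of the length of `x`, each within `C` of `x`. -/
lemma IsBalanced.abs_sub_le {C : ℕ} {ω : ℕ → Fin 3} (h : IsBalanced C ω) {x : List (Fin 3)}
    (hx : IsFactor x ω) (j : ℕ) (b : Fin 3) :
    |ab (pre ω (x.length * j)) b - j * ab x b| ≤ j * C := by
  induction j with
  | zero => simp [pre, ab]
  | succ j ih =>
    have h1 := h _ x ⟨x.length * j, x.length, rfl⟩ hx (by simp) b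
    rw [Nat.mul_succ, pre_add, ab_append, Pi.add_apply]
    change |ab _ b - ab x b| ≤ _ at h1
    push_cast
    rw [abs_le] at *
    constructor <;> linarith [ih.1, ih.2, h1.1, h1.2]

/-- Both terms are compared with the prefix of length `x.length * y.length`; this handles factors of
different lengths. -/
lemma IsBalanced.abs_mul_sub_mul_le {C : ℕ} {ω : ℕ → Fin 3} (h : IsBalanced C ω)
    {x y : List (Fin 3)} (hx : IsFactor x ω) (hy : IsFactor y ω) (b : Fin 3) :
    |(y.length : ℤ) * ab x b - x.length * ab y b| ≤ (x.length + y.length) * C := by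
  have h1 := h.abs_sub_le hx y.length b
  have h2 := h.abs_sub_le hy x.length b
  rw [mul_comm y.length] at h2
  rw [abs_le] at *
  constructor <;> linarith [h1.1, h1.2, h2.1, h2.2]

lemma IsBalanced.hasPair_le {C A : ℕ} {Q : ℤ} {σ : Substitution (Fin 3)} {w ω : ℕ → Fin 3}
    (h : IsBalanced C ω) (hσ : ∀ a, σ a ≠ []) (hQ : ∀ z, norm1 z ≤ Q * norm1 (act σ z))
    (hQ0 : 0 ≤ Q) (hi : IsImage σ w ω) (hw : HasPair A w) : (A : ℤ) ≤ 12 * C * Q := by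
  obtain ⟨u, v, hu, hv, huv⟩ := hw
  set n := (u.flatMap σ).length + (v.flatMap σ).length + 1 with hn
  set y := (pre w n).flatMap σ with hy
  have hyl : n ≤ y.length := by
    have := length_le_length_flatMap hσ (pre w n)
    rwa [length_pre] at this
  have hyf := hi.isFactor (isFactor_pre w n)
  set t : ℤ := (u.flatMap σ).length - (v.flatMap σ).length with ht
  -- The images of u and v may differ in length by `t`; the multiple of a long prefix compensates
  -- for this, so that balance bounds the image of `z`.
  set z : Fin 3 → ℤ := (y.length : ℤ) • (ab u - ab v) + (-t) • ab (pre w n) with hz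
  have hN : (0 : ℤ) < y.length := by omega
  have hact : ∀ b, |act σ z b| ≤ 4 * (y.length * C) := by
    intro b
    have h1 := h.abs_mul_sub_mul_le (hi.isFactor hu) hyf b
    have h2 := h.abs_mul_sub_mul_le (hi.isFactor hv) hyf b
    have e : act σ z b = ((y.length : ℤ) * ab (u.flatMap σ) b - (u.flatMap σ).length * ab y b)
        - ((y.length : ℤ) * ab (v.flatMap σ) b - (v.flatMap σ).length * ab y b) := by
      rw [hz, sub_eq_add_neg (ab u), ← neg_one_smul ℤ (ab v)]
      simp only [act_add, act_smul, act_ab, Pi.add_apply, Pi.smul_apply, smul_eq_mul, ht, ← hy]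
      ring
    rw [e]
    refine (abs_sub _ _).trans ?_
    have h3 : ((u.flatMap σ).length + (v.flatMap σ).length : ℤ) * C ≤ y.length * C := by
      apply mul_le_mul_of_nonneg_right _ (Int.natCast_nonneg C)
      omega
    have hC : (0 : ℤ) ≤ y.length * C := by positivity
    nlinarith
  have hn1 : norm1 (act σ z) ≤ 12 * (y.length * C) := by
    simp only [norm1, Fin.sum_univ_three]
    linarith [hact 0, hact 1, hact 2]
  -- The correction cannot cancel both large coordinates, since they have opposite signs while a
  -- prefix has nonnegative counts: for t ≤ 0 coordinate 0 survives, for t ≥ 0 coordinate 1.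
  have hlow : (y.length : ℤ) * A ≤ norm1 z := by
    have z0 : z 0 = y.length * A + -t * ab (pre w n) 0 := by rw [hz, huv]; simp
    have z1 : z 1 = -(y.length * (A + 1)) + -t * ab (pre w n) 1 := by rw [hz, huv]; simp; ring
    have p0 : (0 : ℤ) ≤ ab (pre w n) 0 := Int.natCast_nonneg _
    have p1 : (0 : ℤ) ≤ ab (pre w n) 1 := Int.natCast_nonneg _
    simp only [norm1, Fin.sum_univ_three]
    rcases le_total t 0 with h0 | h0
    · have := mul_nonneg (neg_nonneg.2 h0) p0
      linarith [le_abs_self (z 0), abs_nonneg (z 1), abs_nonneg (z 2)]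
    · have := mul_nonneg h0 p1
      linarith [neg_le_abs (z 1), abs_nonneg (z 0), abs_nonneg (z 2)]
  have := hlow.trans ((hQ z).trans (mul_le_mul_of_nonneg_left hn1 hQ0))
  refine le_of_mul_le_mul_left ?_ hN
  linarith

/-! ### The sequence `ρ_{c₀} ρ_{c₁} ⋯` -/

lemma isZeta_of_mem_rho {c : ℕ} {ζ : Substitution (Fin 3)} (h : ζ ∈ rho c) : IsZeta ζ := by
  simp only [rho, List.mem_flatMap] at h
  obtain ⟨j, -, h⟩ := h
  simp only [tau, List.mem_append, List.mem_replicate, List.mem_cons, List.not_mem_nil] at h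
  unfold IsZeta
  tauto

lemma rho_eq_append_tau_zero {c : ℕ} (hc : 0 < c) : ∃ l, rho c = l ++ tau 0 := by
  obtain ⟨c, rfl⟩ := Nat.exists_eq_succ_of_ne_zero hc.ne'
  refine ⟨((List.range c).map Nat.succ).reverse.flatMap tau, ?_⟩
  simp [rho, List.range_succ_eq_map]

section RhoSeq

variable {c : ℕ → ℕ} (hc : ∀ k, 0 < c k)
include hc

lemma rho_ne_nil (k : ℕ) : rho (c k) ≠ [] := by
  obtain ⟨l, hl⟩ := rho_eq_append_tau_zero (hc k)
  rw [hl]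
  simp [tau]

lemma le_length_flatMap_rho (k : ℕ) :
    k ≤ ((List.range k).flatMap fun i => rho (c i)).length := by
  have := length_le_length_flatMap (rho_ne_nil hc) (List.range k)
  rwa [List.length_range] at this

lemma rhoSeq_eq_getElem (k i : ℕ) (h : i < ((List.range k).flatMap fun i => rho (c i)).length) :
    rhoSeq c i = ((List.range k).flatMap fun i => rho (c i))[i] :=
  (isInit_infConcat (rho_ne_nil hc) k i h).symm

lemma rhoSeq_add_eq_getElem (k i : ℕ) (h : i < (rho (c k)).length) :
    rhoSeq c (((List.range k).flatMap fun i => rho (c i)).length + i) = (rho (c k))[i] := by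
  have e : (List.range (k + 1)).flatMap (fun i => rho (c i)) =
      (List.range k).flatMap (fun i => rho (c i)) ++ rho (c k) := by
    simp [List.range_succ]
  rw [rhoSeq_eq_getElem hc (k + 1) _ (by rw [e, List.length_append]; omega)]
  simp only [e]
  rw [List.getElem_append_right (by omega)]
  simp only [Nat.add_sub_cancel_left]

lemma isZeta_rhoSeq (n : ℕ) : IsZeta (rhoSeq c n) := by
  have h := le_length_flatMap_rho hc (n + 1)
  rw [rhoSeq_eq_getElem hc (n + 1) n h]
  have := List.getElem_mem h
  obtain ⟨k, -, hk⟩ := List.mem_flatMap.1 this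
  exact isZeta_of_mem_rho hk

lemma exists_tau_zero_rhoSeq (n : ℕ) :
    ∃ p ≥ n, ∀ i (h : i < (tau 0).length), rhoSeq c (p + i) = (tau 0)[i] := by
  obtain ⟨l, hl⟩ := rho_eq_append_tau_zero (hc n)
  refine ⟨((List.range n).flatMap fun i => rho (c i)).length + l.length, ?_, fun i h => ?_⟩
  · have := le_length_flatMap_rho hc n
    omega
  · rw [add_assoc, rhoSeq_add_eq_getElem hc n _ (by rw [hl, List.length_append]; omega)]
    simp only [hl]
    rw [List.getElem_append_right (by omega)]
    simp only [Nat.add_sub_cancel_left]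

lemma existsUnique_isLimitWord_rhoSeq : ∃! ω : ℕ → Fin 3, IsLimitWord (rhoSeq c) ω := by
  apply existsUnique_isLimitWord (fun n => (isZeta_rhoSeq hc n).ne_nil)
  intro n
  obtain ⟨p, hp, h⟩ := exists_tau_zero_rhoSeq hc n
  have e : seg (rhoSeq c) p (tau 0).length = comp (tau 0) := by
    rw [seg]
    congr 1
    apply List.ext_getElem (by simp)
    intro i h1 h2
    simp [h i h2]
  refine ⟨p, hp, (tau 0).length, 2, fun a => ?_⟩
  rw [e, comp_tau_zero]
  revert a
  decide

end RhoSeq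

theorem not_isFinitelyBalanced_of_isLimitWord_rhoSeq {c : ℕ → ℕ}
    (hc : ∀ k, 12 * 3 ^ (∑ i ∈ Finset.range k, (c i * (c i + 1) / 2 + 3 * c i)) * k < c k)
    {ω : ℕ → Fin 3} (hω : IsLimitWord (rhoSeq c) ω) : ¬ IsFinitelyBalanced ω := by
  have hc0 : ∀ k, 0 < c k := fun k => (Nat.zero_le _).trans_lt (hc k)
  rintro ⟨C, hC⟩
  obtain ⟨W, rfl, hW⟩ := (isLimitWord_iff fun n => (isZeta_rhoSeq hc0 n).ne_nil).1 hω
  -- At k = C+1 the hypothesis gives A + 2 > 12·3^N·(C+1), and the surplus 12·3^N absorbs the 2.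
  set l := (List.range (C + 1)).flatMap fun i => rho (c i) with hl
  have himg := IsImage.comp (l := l) hW 0 (by
    intro i h
    rw [zero_add]
    exact rhoSeq_eq_getElem hc0 (C + 1) i h)
  rw [zero_add] at himg
  have hk := hc (C + 1)
  have hpos : 0 < 3 ^ (∑ i ∈ Finset.range (C + 1), (c i * (c i + 1) / 2 + 3 * c i)) := by
    positivity
  have hQ := norm1_le_flatMap_rho c (C + 1)
  generalize (∑ i ∈ Finset.range (C + 1), (c i * (c i + 1) / 2 + 3 * c i)) = N at hk hpos hQ
  obtain ⟨A, hA⟩ : ∃ A, c (C + 1) = A + 2 := Nat.exists_eq_add_of_le' (by nlinarith)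
  have hpair := hasPair_rho (l := rho (c (C + 1))) (by rw [hA]) hW l.length
    (rhoSeq_add_eq_getElem hc0 (C + 1))
  have hne : ∀ a, comp l a ≠ [] := by
    apply comp_ne_nil
    intro ζ hζ
    obtain ⟨k, -, hk⟩ := List.mem_flatMap.1 hζ
    exact (isZeta_of_mem_rho hk).ne_nil
  have hle := hC.hasPair_le hne hQ (by positivity) himg hpair
  have hle' : A ≤ 12 * C * 3 ^ N := by exact_mod_cast hle
  rw [hA] at hk
  nlinarith

end Brun

theorem mainTheorem6 (c : ℕ → ℕ)
    (hc : ∀ k : ℕ, (c k : ℝ) >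
      12 * Real.sqrt 3 *
        3 ^ (∑ i ∈ Finset.range k, (c i * (c i + 1) / 2 + 3 * c i)) * (k : ℝ)) :
    (∃! ω : ℕ → Fin 3, Brun.IsLimitWord (Brun.rhoSeq c) ω) ∧
    (∀ ω : ℕ → Fin 3, Brun.IsLimitWord (Brun.rhoSeq c) ω →
      Brun.IsBrunWord ω ∧ ¬ Brun.IsFinitelyBalanced ω) ∧
    (∀ σ : ℕ → Brun.Substitution (Fin 3),
      Brun.IsBrunDirective σ → Brun.IsRecoding σ (Brun.rhoSeq c) →
        (∃! ω : ℕ → Fin 3, Brun.IsLimitWord σ ω) ∧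
        ∀ ω : ℕ → Fin 3, Brun.IsLimitWord σ ω → ¬ Brun.IsFinitelyBalanced ω) := by
  have hcN : ∀ k, 12 * 3 ^ (∑ i ∈ Finset.range k, (c i * (c i + 1) / 2 + 3 * c i)) * k < c k := by
    intro k
    -- The ℓ¹ estimates need only the constant 12, so the factor √3 is discarded.
    have h1 : (1 : ℝ) ≤ Real.sqrt 3 := Real.one_le_sqrt.2 (by norm_num)
    have h2 : (12 * 3 ^ (∑ i ∈ Finset.range k, (c i * (c i + 1) / 2 + 3 * c i)) * k : ℝ) < c k := by
      refine lt_of_le_of_lt ?_ (hc k)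
      gcongr
      linarith
    exact_mod_cast h2
  have hc0 : ∀ k, 0 < c k := fun k => (Nat.zero_le _).trans_lt (hcN k)
  have hz := Brun.isZeta_rhoSeq hc0
  have huniq := Brun.existsUnique_isLimitWord_rhoSeq hc0
  refine ⟨huniq, fun ω hω => ⟨Brun.isBrunWord_of_isLimitWord hz
    (Brun.exists_tau_zero_rhoSeq hc0) hω,
    Brun.not_isFinitelyBalanced_of_isLimitWord_rhoSeq hcN hω⟩, fun σ hσ hrec => ?_⟩
  obtain ⟨P, hP⟩ := hrec.exists_isRelabelling hσ
  have hσne : ∀ n a, σ n a ≠ [] := by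
    intro n a
    obtain ⟨i, j, -, hn⟩ := hσ.mem n
    rw [hn, Brun.beta]
    split <;> simp
  have back : ∀ ω, Brun.IsLimitWord σ ω →
      Brun.IsLimitWord (Brun.rhoSeq c) (fun i => (P 0).symm (ω i)) :=
    fun ω hω => hP.symm.isLimitWord hσne hω
  refine ⟨?_, fun ω hω hbal => ?_⟩
  · obtain ⟨ω, hω, huω⟩ := huniq
    refine ⟨_, hP.isLimitWord (fun n => (hz n).ne_nil) hω, fun ω' hω' => ?_⟩
    rw [← huω _ (back ω' hω')]
    simp
  · exact Brun.not_isFinitelyBalanced_of_isLimitWord_rhoSeq hcN (back ω hω) (hbal.map (P 0).symm)
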